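/- Let $I\subset\mathbf R$ be an open bounded interval, let $f\colon I\to\mathbf R$ be a $C^\infty$-function, and let $x$ and $h$ be self-adjoint operators on a complex Hilbert space of finite dimension $n$, written in the form \[ x=\sum_{i=1}^n\lambda_i e_{ii},\qquad h=\sum_{i,j=1}^n h_{ij}e_{ij}, \] where $\{e_{ij}\}_{i,j=1}^n$ is a system of matrix units (that is, $e_{ij}e_{kl}=\delta_{jk}e_{il}$, $e_{ij}^*=e_{ji}$ and $\sum_i e_{ii}=1$), $h_{ij}\in\mathbf C$, and $\lambda_1,\dots,\lambda_n\in\mathbf R$ are the eigenvalues of $x$ counted with multiplicity. Assume that the spectrum of $x$ is contained in $I$. For a self-adjoint operator $y=\sum_k\mu_kP_k$ (spectral resolution) with spectrum in $I$ put $f(y)=\sum_k f(\mu_k)P_k$. Then there is $\varepsilon>0$ such that for $|t|<\varepsilon$ the spectrum of $x+th$ is contained in $I$, and the trace function $t\mapsto\operatorname{tr}f(x+th)$ is infinitely differentiable on $(-\varepsilon,\varepsilon)$. Moreover, for every $p=1,2,\dots$, \[ \frac{d^p}{dt^p}\operatorname{tr}f(x+th)\Big|_{t=0} =p!\sum_{i_1=1}^n\cdots\sum_{i_p=1}^n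 h_{i_1i_2}h_{i_2i_3}\cdots h_{i_{p-1}i_p}h_{i_pi_1}\, [\lambda_{i_1},\lambda_{i_2},\dots,\lambda_{i_p},\lambda_{i_1}]_f . \] Here $[x_0,\dots,x_m]_f$ denotes the divided difference of $f$ at the not necessarily distinct points $x_0,\dots,x_m\in I$: it is the symmetric function of the points determined by $[x_0]_f=f(x_0)$, by \[ [x_0,\dots,x_m]_f=\frac{[x_0,\dots,x_{m-1}]_f-[x_1,\dots,x_m]_f}{x_0-x_m}\qquad\text{if } x_0\neq x_m, \] and by $[x_0,\dots,x_0]_f=f^{(m)}(x_0)/m!$ when all $m+1$ points coincide. -/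

import Mathlib

open scoped ContDiff

/-- The divided difference `[x₀, …, xₙ]_f` at a list of nodes in which equal nodes are adjacent
(in particular at a monotone list).  If `x₀ ≠ xₙ` it is
`([x₀, …, xₙ₋₁]_f - [x₁, …, xₙ]_f) / (x₀ - xₙ)`, and for coinciding nodes it is `f⁽ⁿ⁾(x₀) / n!`. -/
noncomputable def dividedDiffSorted (f : ℝ → ℝ) : (n : ℕ) → (Fin (n + 1) → ℝ) → ℝ
  | 0, x => f (x 0)
  | n + 1, x =>
    if x 0 = x (Fin.last (n + 1)) then
      iteratedDeriv (n + 1) f (x 0) / ((n + 1).factorial : ℝ)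
    else
      (dividedDiffSorted f n (Fin.init x) - dividedDiffSorted f n (Fin.tail x)) /
        (x 0 - x (Fin.last (n + 1)))

/-- The divided difference `[x₀, …, xₙ]_f` at arbitrary, not necessarily distinct, nodes.
It is a symmetric function of the nodes, which are first put in increasing order. -/
noncomputable def dividedDiff (f : ℝ → ℝ) {n : ℕ} (x : Fin (n + 1) → ℝ) : ℝ :=
  dividedDiffSorted f n (x ∘ Tuple.sort x)

/-- A (self-adjoint, unital) system of `n × n` matrix units in a unital `*`-ring. -/
structure IsMatrixUnits {A : Type*} [Ring A] [StarRing A] {n : ℕ} (e : Fin n → Fin n → A) :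
    Prop where
  mul_eq : ∀ i j k l, e i j * e k l = if j = k then e i l else 0
  star_eq : ∀ i j, star (e i j) = e j i
  sum_eq_one : ∑ i, e i i = 1

/-- The function `t ↦ tr f(x + t h)` for operators `x`, `h` on a finite dimensional complex
Hilbert space; `f(x + t h)` is given by the functional calculus, which on a self-adjoint operator
with spectral resolution `∑ μᵢ Pᵢ` is `∑ f(μᵢ) Pᵢ`. -/
noncomputable def traceFun {H : Type*} [NormedAddCommGroup H] [InnerProductSpace ℂ H]
    [CompleteSpace H] (f : ℝ → ℝ) (x h : H →L[ℂ] H) (t : ℝ) : ℂ :=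
  LinearMap.trace ℂ H ((cfc f (x + (t : ℂ) • h) : H →L[ℂ] H) : H →ₗ[ℂ] H)

/-!
For a polynomial `q` and `x` diagonal with entries `d`, write `P = D + X M` for the matrix of
`x + t h` over the polynomial ring. Row `i` of `P - d i` is `X` times row `i` of `M`, so splitting
off `X - d i` from `q` peels one step off a walk on the indices, and the coefficient of `X ^ p` in
`q(P)` is a sum over walks of length `p`, weighted by divided differences of `q`. Taking the trace
closes the walks up.

A divided difference of order `p` with nodes in an interval is bounded by the supremum of
`|q⁽ᵖ⁾| / p!` there. Applied at the base point `x + t h` instead of `x`, the polynomial formula thus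
bounds the `p`-th derivative of `tr q(x + t h)` by the supremum of `|q⁽ᵖ⁾|` over an interval
containing all the spectra, uniformly in `t`. Approximating `f` and its derivatives uniformly by
polynomials, both the smoothness and the formula pass to the limit.
-/

section PolyDividedDiff

open Polynomial Lagrange

variable {R S : Type*} [CommRing R] [CommRing S] {n : ℕ}

theorem modByMonic_mul {V W : R[X]} (q : R[X]) (hV : V.Monic) (hW : W.Monic) :
    q %ₘ (V * W) = q %ₘ V + V * ((q /ₘ V) %ₘ W) := by
  nontriviality R
  refine (div_modByMonic_unique (q /ₘ V /ₘ W) _ (hV.mul hW) ⟨?_, ?_⟩).2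
  · linear_combination modByMonic_add_div q V + V * modByMonic_add_div (q /ₘ V) W
  · have hVlt : (q %ₘ V).degree < V.degree := degree_modByMonic_lt q hV
    have hWlt : ((q /ₘ V) %ₘ W).degree < W.degree := degree_modByMonic_lt _ hW
    rw [hV.degree_mul_comm, hV.degree_mul]
    refine (degree_add_le _ _).trans_lt (max_lt (hVlt.trans_le ?_) ?_)
    · exact le_add_of_nonneg_left (zero_le_degree_iff.2 hW.ne_zero)
    · rw [hV.degree_mul_comm, hV.degree_mul]
      exact WithBot.add_lt_add_right (degree_ne_bot.2 hV.ne_zero) hWlt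

/-- The divided difference of a polynomial at not necessarily distinct nodes `x 0, …, x n`,
encoded as the top coefficient of the remainder modulo `∏ i, (X - x i)`: this remainder is the
Hermite interpolation polynomial, so the definition makes sense over any commutative ring and is
visibly symmetric in the nodes and linear in the polynomial. -/
noncomputable def polyDividedDiff (x : Fin (n + 1) → R) : R[X] →ₗ[R] R :=
  lcoeff R n ∘ₗ modByMonicHom (nodal Finset.univ x)

theorem polyDividedDiff_apply (x : Fin (n + 1) → R) (q : R[X]) :
    polyDividedDiff x q = (q %ₘ nodal Finset.univ x).coeff n :=
  rfl

theorem polyDividedDiff_comp_perm (x : Fin (n + 1) → R) (σ : Equiv.Perm (Fin (n + 1)))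
    (q : R[X]) : polyDividedDiff (x ∘ σ) q = polyDividedDiff x q := by
  have hnodal : nodal Finset.univ (x ∘ σ) = nodal Finset.univ x :=
    Equiv.prod_comp σ fun i => X - C (x i)
  rw [polyDividedDiff_apply, hnodal, polyDividedDiff_apply]

theorem polyDividedDiff_zero (x : Fin 1 → R) (q : R[X]) :
    polyDividedDiff x q = q.eval (x 0) := by
  simp [polyDividedDiff_apply, nodal_eq, modByMonic_X_sub_C_eq_C_eval]

theorem coeff_modByMonic_X_sub_C_mul_nodal (a : R) (x : Fin (n + 1) → R) (q : R[X]) :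
    (q %ₘ ((X - C a) * nodal Finset.univ x)).coeff (n + 1) =
      polyDividedDiff x (q /ₘ (X - C a)) := by
  nontriviality R
  set r := (q /ₘ (X - C a)) %ₘ nodal Finset.univ x with hr
  have hr_coeff : r.coeff (n + 1) = 0 := by
    refine coeff_eq_zero_of_degree_lt ?_
    simpa [degree_nodal] using degree_modByMonic_lt (q /ₘ (X - C a))
      (nodal_monic (s := Finset.univ) (v := x))
  rw [modByMonic_mul q (monic_X_sub_C a) nodal_monic, modByMonic_X_sub_C_eq_C_eval, ← hr, sub_mul,
    coeff_add, coeff_C_succ, coeff_sub, coeff_X_mul, coeff_C_mul, hr_coeff, mul_zero, sub_zero,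
    zero_add, polyDividedDiff_apply]

theorem polyDividedDiff_divByMonic_tail (x : Fin (n + 2) → R) (q : R[X]) :
    polyDividedDiff (Fin.tail x) (q /ₘ (X - C (x 0))) = polyDividedDiff x q := by
  rw [← coeff_modByMonic_X_sub_C_mul_nodal, polyDividedDiff_apply, nodal_eq _ x,
    Fin.prod_univ_succ]
  rfl

theorem polyDividedDiff_divByMonic_init (x : Fin (n + 2) → R) (q : R[X]) :
    polyDividedDiff (Fin.init x) (q /ₘ (X - C (x (Fin.last (n + 1))))) = polyDividedDiff x q := by
  rw [← coeff_modByMonic_X_sub_C_mul_nodal, polyDividedDiff_apply, nodal_eq _ x,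
    Fin.prod_univ_castSucc, mul_comm]
  rfl

theorem polyDividedDiff_init_sub_tail (x : Fin (n + 2) → R) (q : R[X]) :
    polyDividedDiff (Fin.init x) q - polyDividedDiff (Fin.tail x) q =
      (x 0 - x (Fin.last (n + 1))) * polyDividedDiff x q := by
  have htail := polyDividedDiff_divByMonic_tail x ((X - C (x 0)) * q)
  have hinit := polyDividedDiff_divByMonic_init x ((X - C (x (Fin.last (n + 1)))) * q)
  rw [mul_divByMonic_cancel_left q (monic_X_sub_C _)] at htail hinit
  rw [htail, hinit, ← map_sub, ← sub_mul, sub_sub_sub_cancel_left, ← C_sub, ← smul_eq_C_mul,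
    map_smul, smul_eq_mul]

theorem polyDividedDiff_map (φ : R →+* S) (x : Fin (n + 1) → R) (q : R[X]) :
    polyDividedDiff (φ ∘ x) (q.map φ) = φ (polyDividedDiff x q) := by
  have hnodal : nodal Finset.univ (φ ∘ x) = (nodal Finset.univ x).map φ := by
    simp [nodal_eq, Polynomial.map_prod]
  rw [polyDividedDiff_apply, hnodal, ← map_modByMonic φ nodal_monic, coeff_map,
    polyDividedDiff_apply]

theorem hasseDeriv_succ_eval_eq (q : R[X]) (a z : R) (k : ℕ) :
    (hasseDeriv (k + 1) q).eval z =
      (z - a) * (hasseDeriv (k + 1) (q /ₘ (X - C a))).eval z +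
        (hasseDeriv k (q /ₘ (X - C a))).eval z := by
  have hq := congrArg (taylor z) (modByMonic_add_div q (X - C a))
  rw [modByMonic_X_sub_C_eq_C_eval, map_add, taylor_mul, map_sub, taylor_X, taylor_C, taylor_C,
    add_sub_assoc, ← C_sub, add_mul] at hq
  simp only [← taylor_coeff]
  rw [← hq, coeff_add, coeff_C_succ, zero_add, coeff_add, coeff_X_mul, coeff_C_mul, add_comm]

theorem polyDividedDiff_const (a : R) (q : R[X]) :
    polyDividedDiff (fun _ : Fin (n + 1) => a) q = (hasseDeriv n q).eval a := by
  induction n generalizing q with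
  | zero => rw [polyDividedDiff_zero, hasseDeriv_zero']
  | succ n ih =>
    rw [← polyDividedDiff_divByMonic_tail, hasseDeriv_succ_eval_eq q a a, sub_self, zero_mul,
      zero_add]
    exact ih _

theorem derivative_hasseDeriv (k : ℕ) (q : R[X]) :
    derivative (hasseDeriv k q) = (k + 1) • hasseDeriv (k + 1) q := by
  simpa [hasseDeriv_one, Nat.choose_one_right, add_comm 1 k, -nsmul_eq_mul] using
    LinearMap.congr_fun (hasseDeriv_comp (R := R) 1 k) q

section Real

variable {s : Set ℝ} {B : ℝ}

theorem abs_hasseDeriv_divByMonic_le (hs : Convex ℝ s) (q : ℝ[X]) (k : ℕ) {a : ℝ} (ha : a ∈ s)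
    (hB : ∀ z ∈ s, |(hasseDeriv (k + 1) q).eval z| ≤ B) {y : ℝ} (hy : y ∈ s) :
    |(hasseDeriv k (q /ₘ (X - C a))).eval y| ≤ B := by
  set r := hasseDeriv k (q /ₘ (X - C a))
  let z : ℝ → ℝ := fun t => a + t * (y - a)
  have hz : ∀ t ∈ Set.Icc (0 : ℝ) 1, z t ∈ s := fun t ht => by
    simpa [z] using hs.add_smul_sub_mem ha hy ht
  have hderiv : ∀ t, HasDerivAt (fun t => t ^ (k + 1) * r.eval (z t))
      ((k + 1) * t ^ k * (hasseDeriv (k + 1) q).eval (z t)) t := fun t => by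
    have hzt : HasDerivAt z (y - a) t := by
      simpa [z] using ((hasDerivAt_id t).mul_const (y - a)).const_add a
    have hrz : HasDerivAt (fun t => r.eval (z t)) ((derivative r).eval (z t) * (y - a)) t :=
      (r.hasDerivAt (z t)).comp t hzt
    refine ((hasDerivAt_pow (k + 1) t).mul hrz).congr_deriv ?_
    rw [hasseDeriv_succ_eval_eq q a, derivative_hasseDeriv]
    simp only [Nat.cast_add, Nat.cast_one, add_tsub_cancel_right, nsmul_eq_mul, eval_mul, eval_add,
      eval_natCast, eval_one, add_sub_cancel_left, z, r]
    ring
  have hbound : ∀ t, HasDerivAt (fun t => t ^ (k + 1) * B) ((k + 1) * t ^ k * B) t := fun t => by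
    simpa using (hasDerivAt_pow (k + 1) t).mul_const B
  have hle := image_norm_le_of_norm_deriv_right_le_deriv_boundary
    (fun t _ => (hderiv t).continuousAt.continuousWithinAt)
    (fun t _ => (hderiv t).hasDerivWithinAt) (by simp) hbound (fun t ht => ?_)
    (Set.right_mem_Icc.2 zero_le_one)
  · simpa [z] using hle
  · have ht0 : 0 ≤ t := ht.1
    rw [norm_mul, Real.norm_of_nonneg (by positivity), Real.norm_eq_abs]
    gcongr
    exact hB _ (hz t ⟨ht.1, ht.2.le⟩)

theorem abs_polyDividedDiff_le (hs : Convex ℝ s) (x : Fin (n + 1) → ℝ) (hx : ∀ i, x i ∈ s)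
    (q : ℝ[X]) (hB : ∀ z ∈ s, |(hasseDeriv n q).eval z| ≤ B) : |polyDividedDiff x q| ≤ B := by
  induction n generalizing q with
  | zero => simpa only [polyDividedDiff_zero, hasseDeriv_zero'] using hB _ (hx 0)
  | succ n ih =>
    rw [← polyDividedDiff_divByMonic_tail]
    exact ih _ (fun i => hx i.succ) _
      fun z hz => abs_hasseDeriv_divByMonic_le hs q n (hx 0) hB hz

end Real

theorem iteratedDeriv_eval_algebraMap {𝕜 A : Type*} [NontriviallyNormedField 𝕜]
    [NontriviallyNormedField A] [NormedAlgebra 𝕜 A] (q : A[X]) (k : ℕ) (t : 𝕜) :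
    iteratedDeriv k (fun t : 𝕜 => q.eval (algebraMap 𝕜 A t)) t =
      k.factorial * (hasseDeriv k q).eval (algebraMap 𝕜 A t) := by
  induction k generalizing t with
  | zero => simp
  | succ k ih =>
    have hmap : HasDerivAt (algebraMap 𝕜 A) 1 t :=
      (algebraMapCLM 𝕜 A).hasDerivAt.congr_deriv (map_one (algebraMap 𝕜 A))
    have heval := (((hasseDeriv k q).hasDerivAt _).comp t hmap).const_mul (k.factorial : A)
    rw [iteratedDeriv_succ, funext ih]
    refine heval.deriv.trans ?_
    rw [derivative_hasseDeriv, Nat.factorial_succ]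
    simp only [nsmul_eq_mul, Nat.cast_add, Nat.cast_one, eval_mul, eval_add, eval_natCast, eval_one,
      mul_one, Nat.cast_mul]
    ring

theorem iteratedDeriv_eval_algebraMap_zero {𝕜 A : Type*} [NontriviallyNormedField 𝕜]
    [NontriviallyNormedField A] [NormedAlgebra 𝕜 A] (q : A[X]) (k : ℕ) :
    iteratedDeriv k (fun t : 𝕜 => q.eval (algebraMap 𝕜 A t)) 0 = k.factorial * q.coeff k := by
  rw [iteratedDeriv_eval_algebraMap, map_zero, ← taylor_coeff, taylor_zero]

theorem iteratedDeriv_eval (q : ℝ[X]) (k : ℕ) (t : ℝ) :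
    iteratedDeriv k (fun t => q.eval t) t = k.factorial * (hasseDeriv k q).eval t :=
  iteratedDeriv_eval_algebraMap q k t

theorem dividedDiffSorted_eval (q : ℝ[X]) {x : Fin (n + 1) → ℝ} (hx : Monotone x) :
    dividedDiffSorted (fun t => q.eval t) n x = polyDividedDiff x q := by
  induction n with
  | zero => rw [dividedDiffSorted, polyDividedDiff_zero]
  | succ n ih =>
    have hinit : Monotone (Fin.init x) := hx.comp Fin.strictMono_castSucc.monotone
    have htail : Monotone (Fin.tail x) := hx.comp (Fin.strictMono_succ).monotone
    rw [dividedDiffSorted]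
    split_ifs with h
    · have hconst : x = fun _ => x 0 :=
        funext fun i => le_antisymm (h ▸ hx (Fin.le_last i)) (hx (Fin.zero_le i))
      rw [iteratedDeriv_eval, mul_div_cancel_left₀ _ (by positivity), hconst,
        polyDividedDiff_const]
    · rw [ih hinit, ih htail, polyDividedDiff_init_sub_tail,
        mul_div_cancel_left₀ _ (sub_ne_zero.2 h)]

theorem dividedDiff_eval (q : ℝ[X]) (x : Fin (n + 1) → ℝ) :
    dividedDiff (fun t => q.eval t) x = polyDividedDiff x q := by
  rw [dividedDiff, dividedDiffSorted_eval q (Tuple.monotone_sort x), polyDividedDiff_comp_perm]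

end PolyDividedDiff

section Pencil

open Polynomial Matrix

variable {R ι : Type*} [CommRing R] {p : ℕ}

/-- The weight `∏ k, M (w k) (w (k + 1))` of the walk `w 0, …, w p` on the index set of `M`. -/
def walkProd (M : Matrix ι ι R) (w : Fin (p + 1) → ι) : R :=
  ∏ k : Fin p, M (w k.castSucc) (w k.succ)

theorem walkProd_cons (M : Matrix ι ι R) (i : ι) (w : Fin (p + 1) → ι) :
    walkProd M (Fin.cons i w : Fin (p + 2) → ι) = M i (w 0) * walkProd M w :=
  Fin.prod_univ_succ _

theorem walkProd_snoc (M : Matrix ι ι R) (i : Fin (p + 1) → ι) :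
    walkProd M (Fin.snoc i (i 0) : Fin (p + 2) → ι) =
      ∏ k, M (i k) (i (finRotate (p + 1) k)) := by
  refine Finset.prod_congr rfl fun k _ => ?_
  rw [Fin.snoc_castSucc (α := fun _ => ι)]
  congr 1
  induction k using Fin.lastCases with
  | last => rw [Fin.succ_last, Fin.snoc_last, finRotate_last]
  | cast k =>
    rw [Fin.succ_castSucc, Fin.snoc_castSucc (α := fun _ => ι), finRotate_apply,
      Fin.coeSucc_eq_succ]

theorem norm_walkProd_le {R : Type*} [NormedCommRing R] [NormOneClass R] {M : Matrix ι ι R} {C : ℝ}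
    (hM : ∀ i j, ‖M i j‖ ≤ C) (w : Fin (p + 1) → ι) : ‖walkProd M w‖ ≤ C ^ p :=
  calc ‖walkProd M w‖
      ≤ ∏ k : Fin p, ‖M (w k.castSucc) (w k.succ)‖ := Finset.norm_prod_le _ _
    _ ≤ ∏ _k : Fin p, C := by gcongr; exact hM _ _
    _ = C ^ p := by rw [Finset.prod_const, Finset.card_univ, Fintype.card_fin]

variable [Fintype ι] [DecidableEq ι]

/-- The matrix pencil `D + X M`, where `D` is the diagonal matrix with entries `d`. Its polynomial
variable plays the role of the parameter `t` in `x + t h`. -/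
noncomputable def pencil (d : ι → R) (M : Matrix ι ι R) : Matrix ι ι R[X] :=
  diagonal (fun i => C (d i)) + (X : R[X]) • M.map C

theorem aeval_pencil_apply (d : ι → R) (M : Matrix ι ι R) (q : R[X]) (i j : ι) :
    aeval (pencil d M) q i j =
      (if i = j then C (q.eval (d i)) else 0) +
        X * ∑ k, C (M i k) * aeval (pencil d M) (q /ₘ (X - C (d i))) k j := by
  set r := q /ₘ (X - C (d i))
  have hq : aeval (pencil d M) q = algebraMap R _ (q.eval (d i)) +
      (pencil d M - algebraMap R _ (d i)) * aeval (pencil d M) r := by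
    conv_lhs => rw [← modByMonic_add_div q (X - C (d i)), modByMonic_X_sub_C_eq_C_eval]
    simp only [map_add, map_mul, map_sub, aeval_X, aeval_C, r]
  have hrow : ∀ k, (pencil d M - algebraMap R _ (d i)) i k = X * C (M i k) := fun k => by
    by_cases hik : i = k <;>
      simp [pencil, algebraMap_matrix_apply, hik]
  rw [hq, Matrix.add_apply, mul_apply, algebraMap_matrix_apply, Finset.mul_sum]
  simp only [hrow, mul_assoc, Polynomial.algebraMap_apply, Algebra.algebraMap_self_apply]

theorem coeff_aeval_pencil (d : ι → R) (M : Matrix ι ι R) (q : R[X]) (p : ℕ) (i j : ι) :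
    (aeval (pencil d M) q i j).coeff p =
      ∑ w : Fin (p + 1) → ι with w 0 = i ∧ w (Fin.last p) = j,
        walkProd M w * polyDividedDiff (d ∘ w) q := by
  rw [Finset.sum_filter]
  induction p generalizing q i with
  | zero =>
    rw [aeval_pencil_apply, coeff_add, coeff_X_mul_zero, add_zero,
      ← (Equiv.funUnique (Fin 1) ι).symm.sum_comp]
    simp [walkProd, polyDividedDiff_zero, ite_and, apply_ite (coeff · 0)]
  | succ p ih =>
    have hconst : (if i = j then C (q.eval (d i)) else 0).coeff (p + 1) = 0 := by
      split_ifs <;> simp only [coeff_C_succ, coeff_zero]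
    have hcons : ∀ (k : ι) (w : Fin (p + 1) → ι),
        polyDividedDiff (d ∘ (Fin.cons k w : Fin (p + 2) → ι)) q =
          polyDividedDiff (d ∘ w) (q /ₘ (X - C (d k))) :=
      fun k w => (polyDividedDiff_divByMonic_tail _ q).symm
    rw [aeval_pencil_apply, coeff_add, hconst, zero_add, coeff_X_mul, finsetSum_coeff,
      ← (Fin.consEquiv fun _ => ι).sum_comp, Fintype.sum_prod_type]
    simp only [coeff_C_mul, ih, Fin.consEquiv, Equiv.coe_fn_mk, walkProd_cons, Finset.mul_sum,
      hcons, Fin.cons_zero, ← Fin.succ_last, Fin.cons_succ]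
    rw [Finset.sum_comm, Finset.sum_comm (s := Finset.univ) (t := Finset.univ)
      (f := fun (a : ι) (w : Fin (p + 1) → ι) => ite (a = i ∧ _) _ _)]
    simp [ite_and, mul_assoc]

theorem coeff_trace_aeval_pencil (d : ι → R) (M : Matrix ι ι R) (q : R[X]) (p : ℕ) :
    (trace (aeval (pencil d M) q)).coeff p =
      ∑ w : Fin (p + 1) → ι with w 0 = w (Fin.last p),
        walkProd M w * polyDividedDiff (d ∘ w) q := by
  simp only [trace, diag_apply, finsetSum_coeff, coeff_aeval_pencil, Finset.sum_filter]
  rw [Finset.sum_comm]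
  simp [ite_and, eq_comm]

theorem sum_closed_eq_sum_snoc {α : Type*} [AddCommMonoid α] (g : (Fin (p + 2) → ι) → α) :
    ∑ w : Fin (p + 2) → ι with w 0 = w (Fin.last (p + 1)), g w =
      ∑ i : Fin (p + 1) → ι, g (Fin.snoc i (i 0)) := by
  symm
  have hsnoc : ∀ i : Fin (p + 1) → ι, (Fin.snoc i (i 0) : Fin (p + 2) → ι) 0 = i 0 := fun i =>
    Fin.snoc_castSucc (α := fun _ => ι) (i 0) i 0
  refine Finset.sum_nbij' (fun i => Fin.snoc i (i 0)) Fin.init (fun i _ => ?_)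
    (fun w _ => Finset.mem_univ _) (fun i _ => Fin.init_snoc _ _) (fun w hw => ?_)
    fun i _ => rfl
  · rw [Finset.mem_filter_univ, hsnoc, Fin.snoc_last]
  · have hclosed : Fin.init w 0 = w (Fin.last (p + 1)) := (Finset.mem_filter_univ w).1 hw
    rw [hclosed, Fin.snoc_init_self]

theorem trace_aeval_add_smul {V : Type*} [AddCommGroup V] [Module R V]
    (b : Module.Basis ι R V) (x h : Module.End R V) (d : ι → R) (hx : ∀ i, x (b i) = d i • b i)
    (q : R[X]) (t : R) :
    LinearMap.trace R V (aeval (x + t • h) q) =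
      (trace (aeval (pencil d (LinearMap.toMatrix b b h)) q)).eval t := by
  let φ := LinearMap.toMatrixAlgEquiv b
  let evalAt : Matrix ι ι R[X] →ₐ[R] Matrix ι ι R := (aeval t).mapMatrix
  have hxφ : φ x = diagonal d := by
    ext i j
    by_cases hij : i = j <;> simp [φ, LinearMap.toMatrixAlgEquiv_apply, hx, hij]
  have hpencil : evalAt (pencil d (φ h)) = φ (x + t • h) := by
    ext i j
    by_cases hij : i = j <;> simp [evalAt, pencil, hxφ, hij, mul_comm t]
  calc LinearMap.trace R V (aeval (x + t • h) q)
      = trace (φ (aeval (x + t • h) q)) := LinearMap.trace_eq_matrix_trace R b _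
    _ = trace (evalAt (aeval (pencil d (φ h)) q)) := by
        rw [← aeval_algHom_apply evalAt, hpencil, ← aeval_algHom_apply φ]
    _ = (trace (aeval (pencil d (φ h)) q)).eval t := by
        simp [trace, evalAt, eval_finsetSum, coe_aeval_eq_eval]

end Pencil

section UniformLimits

open Filter Topology

variable {𝕜 E κ : Type*} [RCLike 𝕜] [NormedAddCommGroup E] [NormedSpace 𝕜 E]
  {l : Filter κ} [l.NeBot] {U : Set 𝕜} {N : ℕ∞} {F : κ → 𝕜 → E} {G : 𝕜 → E}

theorem hasDerivAt_iteratedDeriv_of_tendstoUniformlyOn {g : 𝕜 → E} {k : ℕ} {t : 𝕜} (hU : IsOpen U)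
    (hF : ∀ m, ContDiff 𝕜 N (F m)) (hk : (k : ℕ∞) < N)
    (hg : TendstoUniformlyOn (fun m => iteratedDeriv (k + 1) (F m)) g l U)
    (hG : TendstoUniformlyOn (fun m => iteratedDeriv k (F m)) (iteratedDeriv k G) l U)
    (ht : t ∈ U) : HasDerivAt (iteratedDeriv k G) (g t) t := by
  refine hasDerivAt_of_tendstoUniformlyOn hU hg (Eventually.of_forall fun m s _ => ?_)
    (fun s hs => hG.tendsto_at hs) ht
  rw [iteratedDeriv_succ]
  exact ((hF m).differentiable_iteratedDeriv k (mod_cast hk)).differentiableAt.hasDerivAt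

theorem tendstoUniformlyOn_iteratedDeriv [CompleteSpace E] (hU : IsOpen U)
    (hF : ∀ m, ContDiff 𝕜 N (F m))
    (hcauchy : ∀ k : ℕ, (k : ℕ∞) ≤ N → UniformCauchySeqOn (fun m => iteratedDeriv k (F m)) l U)
    (hG : ∀ t ∈ U, Tendsto (fun m => F m t) l (𝓝 (G t))) (k : ℕ) (hk : (k : ℕ∞) ≤ N) :
    TendstoUniformlyOn (fun m => iteratedDeriv k (F m)) (iteratedDeriv k G) l U := by
  induction k with
  | zero => exact (hcauchy 0 hk).tendstoUniformlyOn_of_tendsto hG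
  | succ k ih =>
    have hkN : (k : ℕ∞) < N := (Nat.cast_lt.2 k.lt_succ_self).trans_le hk
    have hlim : ∀ t : 𝕜, ∃ y, t ∈ U →
        Tendsto (fun m => iteratedDeriv (k + 1) (F m) t) l (𝓝 y) := fun t => by
      by_cases ht : t ∈ U
      · obtain ⟨y, hy⟩ := CompleteSpace.complete ((hcauchy (k + 1) hk).cauchy_map ht)
        exact ⟨y, fun _ => hy⟩
      · exact ⟨0, fun h => absurd h ht⟩
    choose g hg using hlim
    have hunif : TendstoUniformlyOn (fun m => iteratedDeriv (k + 1) (F m)) g l U :=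
      (hcauchy (k + 1) hk).tendstoUniformlyOn_of_tendsto hg
    refine hunif.congr_right fun t ht => ?_
    rw [iteratedDeriv_succ,
      (hasDerivAt_iteratedDeriv_of_tendstoUniformlyOn hU hF hkN hunif (ih hkN.le) ht).deriv]

theorem contDiffOn_of_tendstoUniformlyOn_iteratedDeriv (hU : IsOpen U)
    (hF : ∀ m, ContDiff 𝕜 N (F m))
    (hlim : ∀ k : ℕ, (k : ℕ∞) ≤ N →
      TendstoUniformlyOn (fun m => iteratedDeriv k (F m)) (iteratedDeriv k G) l U) :
    ContDiffOn 𝕜 N G U := by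
  have heq (k : ℕ) := iteratedDerivWithin_of_isOpen (𝕜 := 𝕜) (n := k) (f := G) hU
  refine contDiffOn_of_continuousOn_differentiableOn_deriv (fun k hk => ?_) fun k hk => ?_
  · refine ContinuousOn.congr ((hlim k hk).continuousOn ?_) (heq k)
    exact Frequently.of_forall fun m =>
      ((hF m).continuous_iteratedDeriv k (mod_cast hk)).continuousOn
  · refine DifferentiableOn.congr (fun t ht => ?_) (heq k)
    exact (hasDerivAt_iteratedDeriv_of_tendstoUniformlyOn hU hF hk
      (hlim (k + 1) (Order.add_one_le_of_lt hk)) (hlim k hk.le)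
      ht).differentiableAt.differentiableWithinAt

end UniformLimits

section Approximation

open Polynomial Filter Topology

theorem derivative_surjective {K : Type*} [Field K] [CharZero K] :
    Function.Surjective (derivative : K[X] →ₗ[K] K[X]) := by
  intro r
  induction r using Polynomial.induction_on' with
  | add p q hp hq =>
    obtain ⟨⟨P, rfl⟩, Q, rfl⟩ := And.intro hp hq
    exact ⟨P + Q, map_add _ P Q⟩
  | monomial n a =>
    refine ⟨monomial (n + 1) (a / (n + 1)), ?_⟩
    rw [derivative_monomial, Nat.cast_succ, div_mul_cancel₀ a n.cast_add_one_ne_zero,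
      Nat.add_sub_cancel]

theorem norm_sub_le_of_norm_hasDerivWithinAt_sub_le {E : Type*} [NormedAddCommGroup E]
    [NormedSpace ℝ E] {f g f' g' : ℝ → E} {c d B : ℝ}
    (hf : ∀ z ∈ Set.Icc c d, HasDerivWithinAt f (f' z) (Set.Icc c d) z)
    (hg : ∀ z ∈ Set.Icc c d, HasDerivWithinAt g (g' z) (Set.Icc c d) z) (hfg : f c = g c)
    (hB : ∀ z ∈ Set.Icc c d, ‖f' z - g' z‖ ≤ B) {y : ℝ} (hy : y ∈ Set.Icc c d) :
    ‖f y - g y‖ ≤ B * (y - c) := by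
  have hmean := (convex_Icc c d).norm_image_sub_le_of_norm_hasDerivWithin_le
    (fun z hz => (hf z hz).sub (hg z hz)) hB (Set.left_mem_Icc.2 (hy.1.trans hy.2)) hy
  rwa [Pi.sub_apply, Pi.sub_apply, hfg, sub_self, sub_zero,
    Real.norm_of_nonneg (sub_nonneg.2 hy.1)] at hmean

theorem exists_polynomial_iteratedDeriv_near {U : Set ℝ} (hU : IsOpen U) {c d : ℝ}
    (hcd : Set.Icc c d ⊆ U) {n : ℕ} {f : ℝ → ℝ} (hf : ContDiffOn ℝ n f U) {δ : ℝ} (hδ : 0 < δ) :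
    ∃ q : ℝ[X], ∀ k ≤ n, ∀ y ∈ Set.Icc c d,
      |iteratedDeriv k (fun t => q.eval t) y - iteratedDeriv k f y| ≤ δ := by
  induction n generalizing f δ with
  | zero =>
    obtain ⟨q, hq⟩ :=
      exists_polynomial_near_of_continuousOn c d f (hf.continuousOn.mono hcd) δ hδ
    refine ⟨q, fun k hk y hy => ?_⟩
    obtain rfl := Nat.le_zero.1 hk
    simpa only [iteratedDeriv_zero] using (hq y hy).le
  | succ n ih =>
    push_cast at hf
    obtain ⟨hdiff, -, hderiv⟩ := (contDiffOn_succ_iff_deriv_of_isOpen hU).1 hf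
    set L := |d - c| + 1
    have hL1 : 1 ≤ L := le_add_of_nonneg_left (abs_nonneg _)
    obtain ⟨r, hr⟩ := ih hderiv (δ := δ / L) (by positivity)
    obtain ⟨q₀, rfl⟩ := derivative_surjective r
    set q := q₀ + C (f c - q₀.eval c)
    have hq : deriv (fun t => q.eval t) = fun t => (derivative q₀).eval t := by
      funext t; simp [q]
    refine ⟨q, fun k hk y hy => ?_⟩
    cases k with
    | zero =>
      have hyL : y - c ≤ L := by linarith [hy.2, le_abs_self (d - c)]
      calc |q.eval y - f y|
          ≤ δ / L * (y - c) := norm_sub_le_of_norm_hasDerivWithinAt_sub_le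
            (fun z _ => (q.hasDerivAt z).hasDerivWithinAt)
            (fun z hz => (hdiff.hasDerivAt (hU.mem_nhds (hcd hz))).hasDerivWithinAt)
            (by simp [q]) (fun z hz => by simpa [q] using hr 0 n.zero_le z hz) hy
        _ ≤ δ / L * L := by gcongr
        _ = δ := div_mul_cancel₀ δ (by positivity)
    | succ k =>
      rw [iteratedDeriv_succ', hq, iteratedDeriv_succ']
      exact (hr k (Nat.le_of_succ_le_succ hk) y hy).trans (div_le_self hδ.le hL1)

theorem exists_polynomial_seq_tendstoUniformlyOn {U : Set ℝ} (hU : IsOpen U) {c d : ℝ}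
    (hcd : Set.Icc c d ⊆ U) {N : ℕ∞} {f : ℝ → ℝ} (hf : ContDiffOn ℝ N f U) :
    ∃ q : ℕ → ℝ[X], ∀ k : ℕ, (k : ℕ∞) ≤ N →
      TendstoUniformlyOn (fun m => iteratedDeriv k fun t => (q m).eval t) (iteratedDeriv k f) atTop
        (Set.Icc c d) := by
  choose n hn using fun m : ℕ => ENat.ne_top_iff_exists.1
    (ne_top_of_le_ne_top (ENat.natCast_ne_top m) (min_le_left (m : ℕ∞) N))
  have hnN (m : ℕ) : (n m : ℕ∞) ≤ N := (hn m).trans_le (min_le_right _ _)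
  choose q hq using fun m : ℕ => exists_polynomial_iteratedDeriv_near hU hcd
    (hf.of_le (mod_cast hnN m)) (Nat.one_div_pos_of_nat (α := ℝ) (n := m))
  refine ⟨q, fun k hk => Metric.tendstoUniformlyOn_iff.2 fun ε hε => ?_⟩
  filter_upwards [eventually_ge_atTop k,
    (tendsto_one_div_add_atTop_nhds_zero_nat (𝕜 := ℝ)).eventually_lt_const hε] with m hkm hmε y hy
  rw [dist_comm, Real.dist_eq]
  have hkn : (k : ℕ∞) ≤ n m := (le_min (Nat.cast_le.2 hkm) hk).trans_eq (hn m).symm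
  exact (hq m k (Nat.cast_le.1 hkn) y hy).trans_lt hmε

theorem tendsto_dividedDiffSorted {κ : Type*} {l : Filter κ} {F : κ → ℝ → ℝ} {f : ℝ → ℝ} {n : ℕ}
    (x : Fin (n + 1) → ℝ)
    (h : ∀ k ≤ n, ∀ i,
      Tendsto (fun m => iteratedDeriv k (F m) (x i)) l (𝓝 (iteratedDeriv k f (x i)))) :
    Tendsto (fun m => dividedDiffSorted (F m) n x) l (𝓝 (dividedDiffSorted f n x)) := by
  induction n with
  | zero => simpa only [dividedDiffSorted, iteratedDeriv_zero] using h 0 le_rfl 0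
  | succ n ih =>
    simp only [dividedDiffSorted]
    split_ifs
    · exact (h _ le_rfl _).div_const _
    · exact ((ih (Fin.init x) fun k hk i => h k (hk.trans n.le_succ) i.castSucc).sub
        (ih (Fin.tail x) fun k hk i => h k (hk.trans n.le_succ) i.succ)).div_const _

theorem tendsto_dividedDiff {κ : Type*} {l : Filter κ} {F : κ → ℝ → ℝ} {f : ℝ → ℝ} {n : ℕ}
    (x : Fin (n + 1) → ℝ)
    (h : ∀ k ≤ n, ∀ i,
      Tendsto (fun m => iteratedDeriv k (F m) (x i)) l (𝓝 (iteratedDeriv k f (x i)))) :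
    Tendsto (fun m => dividedDiff (F m) x) l (𝓝 (dividedDiff f x)) :=
  tendsto_dividedDiffSorted _ fun k hk i => h k hk (Tuple.sort x i)

end Approximation

section Operators

open scoped InnerProductSpace

variable {𝕜 H : Type*} [RCLike 𝕜] [NormedAddCommGroup H] [InnerProductSpace 𝕜 H]

theorem norm_toMatrix_apply_le {ι : Type*} [Fintype ι] [DecidableEq ι]
    (b : OrthonormalBasis ι 𝕜 H) (h : H →L[𝕜] H) (i j : ι) :
    ‖LinearMap.toMatrix b.toBasis b.toBasis (h : H →ₗ[𝕜] H) i j‖ ≤ ‖h‖ :=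
  calc ‖LinearMap.toMatrix b.toBasis b.toBasis (h : H →ₗ[𝕜] H) i j‖
      = ‖⟪b i, h (b j)⟫_𝕜‖ := by
        rw [LinearMap.toMatrix_apply, b.coe_toBasis_repr_apply, b.repr_apply_apply, b.coe_toBasis,
          ContinuousLinearMap.coe_coe]
    _ ≤ ‖b i‖ * ‖h (b j)‖ := norm_inner_le_norm _ _
    _ ≤ ‖b i‖ * (‖h‖ * ‖b j‖) := by gcongr; exact h.le_opNorm _
    _ = ‖h‖ := by rw [b.norm_eq_one, b.norm_eq_one, one_mul, mul_one]

theorem mem_spectrum_of_apply_eq_smul {H : Type*} [NormedAddCommGroup H] [InnerProductSpace ℂ H]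
    [CompleteSpace H] {x : H →L[ℂ] H} {v : H} (hv : v ≠ 0) {μ : ℝ} (hx : x v = (μ : ℂ) • v) :
    μ ∈ spectrum ℝ x := by
  refine (spectrum.algebraMap_mem_iff ℂ).1 ?_
  rw [ContinuousLinearMap.spectrum_eq]
  exact (Module.End.hasEigenvalue_of_hasEigenvector
    ⟨Module.End.mem_eigenspace_iff.2 hx, hv⟩).mem_spectrum

theorem exists_orthonormalBasis_apply_eq_smul {H : Type*} [NormedAddCommGroup H]
    [InnerProductSpace ℂ H] [FiniteDimensional ℂ H] [CompleteSpace H] {x : H →L[ℂ] H}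
    (hx : IsSelfAdjoint x) :
    ∃ (b : OrthonormalBasis (Fin (Module.finrank ℂ H)) ℂ H) (d : Fin (Module.finrank ℂ H) → ℝ),
      (∀ i, x (b i) = (d i : ℂ) • b i) ∧ ∀ i, d i ∈ spectrum ℝ x := by
  have hsym := ContinuousLinearMap.isSelfAdjoint_iff_isSymmetric.1 hx
  have heigen := hsym.apply_eigenvectorBasis rfl
  exact ⟨hsym.eigenvectorBasis rfl, hsym.eigenvalues rfl, heigen, fun i =>
    mem_spectrum_of_apply_eq_smul ((hsym.eigenvectorBasis rfl).orthonormal.ne_zero i) (heigen i)⟩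

namespace IsMatrixUnits

variable [CompleteSpace H] {n : ℕ} {e : Fin n → Fin n → (H →L[𝕜] H)}

theorem apply_apply (he : IsMatrixUnits e) (i j k l : Fin n) (v : H) :
    e i j (e k l v) = if j = k then e i l v else 0 := by
  rw [← mul_apply_eq_comp, he.mul_eq]
  split_ifs <;> rfl

theorem exists_norm_eq_one_apply_eq_self [Nontrivial H] (he : IsMatrixUnits e) :
    ∃ (k : Fin n) (v : H), ‖v‖ = 1 ∧ e k k v = v := by
  obtain ⟨k, -, hk⟩ := Finset.exists_ne_zero_of_sum_ne_zero
    (he.sum_eq_one.trans_ne (one_ne_zero (α := H →L[𝕜] H)))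
  obtain ⟨u, hu⟩ := DFunLike.ne_iff.1 hk
  refine ⟨k, ((‖e k k u‖⁻¹ : ℝ) : 𝕜) • e k k u, ?_, ?_⟩
  · simpa using norm_smul_inv_norm (𝕜 := 𝕜) hu
  · rw [map_smul, he.apply_apply, if_pos rfl]

theorem orthonormal (he : IsMatrixUnits e) {k : Fin n} {v : H} (hv : ‖v‖ = 1)
    (hfix : e k k v = v) : Orthonormal 𝕜 fun i => e i k v := by
  refine orthonormal_iff_ite.2 fun i j => ?_
  calc ⟪e i k v, e j k v⟫_𝕜
      = ⟪v, e k i (e j k v)⟫_𝕜 := by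
        rw [← he.star_eq i k, ContinuousLinearMap.star_eq_adjoint,
          ContinuousLinearMap.adjoint_inner_right]
    _ = if i = j then 1 else 0 := by
        rw [he.apply_apply, hfix, apply_ite (inner 𝕜 v), inner_zero_right,
          inner_self_eq_one_of_norm_eq_one hv]

theorem exists_orthonormalBasis [FiniteDimensional 𝕜 H] (hn : Module.finrank 𝕜 H = n)
    (he : IsMatrixUnits e) :
    ∃ b : OrthonormalBasis (Fin n) 𝕜 H, ∀ i j k, e i j (b k) = if j = k then b i else 0 := by
  rcases subsingleton_or_nontrivial H with hH | hH
  · exact ⟨(stdOrthonormalBasis 𝕜 H).reindex (finCongr hn), fun _ _ _ => Subsingleton.elim _ _⟩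
  · obtain ⟨k, v, hv, hfix⟩ := he.exists_norm_eq_one_apply_eq_self
    have hspan := (he.orthonormal hv hfix).linearIndependent.span_eq_top_of_card_eq_finrank'
      (by rw [Fintype.card_fin, hn])
    refine ⟨OrthonormalBasis.mk (he.orthonormal hv hfix) hspan.ge, fun i j l => ?_⟩
    simp only [OrthonormalBasis.coe_mk, he.apply_apply]

end IsMatrixUnits

end Operators

section SpectrumStability

open Filter Topology

theorem exists_Icc_mem_nhdsSet {J K : Set ℝ} (hJ : IsOpen J) (hJc : J.OrdConnected)
    (hK : IsCompact K) (hKJ : K ⊆ J) : ∃ c d, Set.Icc c d ⊆ J ∧ Set.Icc c d ∈ 𝓝ˢ K := by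
  rcases K.eq_empty_or_nonempty with rfl | hne
  · exact ⟨1, 0, by simp, by simp⟩
  · obtain ⟨m, hm, hmin⟩ := hK.exists_isLeast hne
    obtain ⟨M, hM, hmax⟩ := hK.exists_isGreatest hne
    obtain ⟨c, hcm, hc⟩ := mem_nhdsLE_iff_exists_Icc_subset.1
      (nhdsWithin_le_nhds (hJ.mem_nhds (hKJ hm)))
    obtain ⟨d, hMd, hd⟩ := mem_nhdsGE_iff_exists_Icc_subset.1
      (nhdsWithin_le_nhds (hJ.mem_nhds (hKJ hM)))
    refine ⟨c, d, hJc.out (hc (Set.left_mem_Icc.2 (le_of_lt hcm)))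
      (hd (Set.right_mem_Icc.2 (le_of_lt hMd))), mem_nhdsSet_iff_forall.2 fun z hz => ?_⟩
    exact Icc_mem_nhds (hcm.trans_le (hmin hz)) ((hmax hz).trans_lt hMd)

theorem eventually_spectrum_add_smul_subset {A : Type*} [NormedRing A] [NormedAlgebra ℝ A]
    [CompleteSpace A] (x h : A) {s : Set ℝ} (hs : s ∈ 𝓝ˢ (spectrum ℝ x)) :
    ∀ᶠ t : ℝ in 𝓝 0, spectrum ℝ (x + t • h) ⊆ s := by
  have hcont : Tendsto (fun t : ℝ => x + t • h) (𝓝 0) (𝓝 x) :=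
    Continuous.tendsto' (by fun_prop) _ _ (by rw [zero_smul, add_zero])
  filter_upwards [hcont.eventually
    ((upperHemicontinuous_spectrum ℝ A).upperHemicontinuousAt x s hs)] with t ht
  exact subset_of_mem_nhdsSet ht

theorem exists_spectrum_add_smul_subset_Icc {A : Type*} [NormedRing A] [NormedAlgebra ℝ A]
    [CompleteSpace A] {J : Set ℝ} (hJ : IsOpen J) (hJc : J.OrdConnected) (x h : A)
    (hspec : spectrum ℝ x ⊆ J) :
    ∃ c d : ℝ, Set.Icc c d ⊆ J ∧ ∃ ε : ℝ, 0 < ε ∧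
      ∀ t ∈ Set.Ioo (-ε) ε, spectrum ℝ (x + t • h) ⊆ Set.Icc c d := by
  obtain ⟨c, d, hcd, hnhds⟩ := exists_Icc_mem_nhdsSet hJ hJc (spectrum.isCompact x) hspec
  obtain ⟨ε, hε, hball⟩ := Metric.eventually_nhds_iff.1
    (eventually_spectrum_add_smul_subset x h hnhds)
  exact ⟨c, d, hcd, ε, hε, fun t ht => hball (by rwa [Real.dist_0_eq_abs, abs_lt])⟩

end SpectrumStability

section TraceFun

open Polynomial Matrix Filter Topology

variable {H : Type*} [NormedAddCommGroup H] [InnerProductSpace ℂ H] [CompleteSpace H]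
  {x h : H →L[ℂ] H}

theorem isSelfAdjoint_add_ofReal_smul (hx : IsSelfAdjoint x) (hh : IsSelfAdjoint h) (t : ℝ) :
    IsSelfAdjoint (x + (t : ℂ) • h) :=
  hx.add (IsSelfAdjoint.smul (Complex.conj_ofReal t) hh)

theorem traceFun_add (f : ℝ → ℝ) (x h : H →L[ℂ] H) (s t : ℝ) :
    traceFun f x h (s + t) = traceFun f (x + (s : ℂ) • h) h t := by
  simp only [traceFun, Complex.ofReal_add, add_smul, add_assoc]

theorem iteratedDeriv_traceFun (f : ℝ → ℝ) (x h : H →L[ℂ] H) (k : ℕ) (t : ℝ) :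
    iteratedDeriv k (traceFun f x h) t = iteratedDeriv k (traceFun f (x + (t : ℂ) • h) h) 0 := by
  have hshift := congrFun (iteratedDeriv_comp_const_add k (traceFun f x h) t) 0
  simpa only [traceFun_add, add_zero] using hshift.symm

theorem traceFun_eval (hx : IsSelfAdjoint x) (hh : IsSelfAdjoint h) (q : ℝ[X]) (t : ℝ) :
    traceFun (fun s => q.eval s) x h t =
      LinearMap.trace ℂ H (aeval ((x : H →ₗ[ℂ] H) + (t : ℂ) • (h : H →ₗ[ℂ] H))
        (q.map (algebraMap ℝ ℂ))) := by
  rw [traceFun, cfc_polynomial q _ (isSelfAdjoint_add_ofReal_smul hx hh t), aeval_map_algebraMap]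
  congr 1
  exact (map_aeval_eq_aeval_map (ψ := ContinuousLinearMap.toLinearMapRingHom) (φ := RingHom.id ℝ)
    rfl q _).trans (by rw [Polynomial.map_id]; rfl)

theorem traceFun_eval_sub (hx : IsSelfAdjoint x) (hh : IsSelfAdjoint h) (q r : ℝ[X]) :
    traceFun (fun s => (q - r).eval s) x h =
      traceFun (fun s => q.eval s) x h - traceFun (fun s => r.eval s) x h := by
  funext t
  simp only [traceFun_eval hx hh, Polynomial.map_sub, map_sub, Pi.sub_apply]

section Diagonal

variable {ι : Type*} [Fintype ι] [DecidableEq ι] (b : Module.Basis ι ℂ H) {d : ι → ℝ}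

theorem traceFun_eval_eq_eval_pencil (hx : IsSelfAdjoint x) (hh : IsSelfAdjoint h)
    (hd : ∀ i, x (b i) = (d i : ℂ) • b i) (q : ℝ[X]) :
    traceFun (fun s => q.eval s) x h = fun t : ℝ =>
      (trace (aeval (pencil (algebraMap ℝ ℂ ∘ d) (LinearMap.toMatrix b b (h : H →ₗ[ℂ] H)))
        (q.map (algebraMap ℝ ℂ)))).eval (algebraMap ℝ ℂ t) := by
  funext t
  rw [traceFun_eval hx hh]
  exact trace_aeval_add_smul b _ _ (algebraMap ℝ ℂ ∘ d) hd _ _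

theorem iteratedDeriv_traceFun_eval_zero (hx : IsSelfAdjoint x) (hh : IsSelfAdjoint h)
    (hd : ∀ i, x (b i) = (d i : ℂ) • b i) (q : ℝ[X]) (p : ℕ) :
    iteratedDeriv p (traceFun (fun s => q.eval s) x h) 0 =
      p.factorial * ∑ w : Fin (p + 1) → ι with w 0 = w (Fin.last p),
        walkProd (LinearMap.toMatrix b b (h : H →ₗ[ℂ] H)) w * (polyDividedDiff (d ∘ w) q : ℝ) := by
  rw [traceFun_eval_eq_eval_pencil b hx hh hd, iteratedDeriv_eval_algebraMap_zero,
    coeff_trace_aeval_pencil]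
  simp only [Function.comp_assoc, polyDividedDiff_map]
  rfl

end Diagonal

variable [FiniteDimensional ℂ H]

theorem contDiff_traceFun_eval {N : WithTop ℕ∞} (hx : IsSelfAdjoint x) (hh : IsSelfAdjoint h)
    (q : ℝ[X]) : ContDiff ℝ N (traceFun (fun s => q.eval s) x h) := by
  obtain ⟨b, d, hxb, -⟩ := exists_orthonormalBasis_apply_eq_smul hx
  rw [← b.coe_toBasis] at hxb
  rw [traceFun_eval_eq_eval_pencil b.toBasis hx hh hxb]
  simp only [← coe_aeval_eq_eval]
  exact ((Polynomial.contDiff_aeval _ _).restrict_scalars ℝ).comp Complex.ofRealCLM.contDiff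

theorem norm_iteratedDeriv_traceFun_eval_zero_le (hx : IsSelfAdjoint x) (hh : IsSelfAdjoint h)
    {s : Set ℝ} (hs : Convex ℝ s) (hspec : spectrum ℝ x ⊆ s) (q : ℝ[X]) {p : ℕ} {B : ℝ}
    (hB : ∀ z ∈ s, |iteratedDeriv p (fun z => q.eval z) z| ≤ B) :
    ‖iteratedDeriv p (traceFun (fun s => q.eval s) x h) 0‖ ≤
      Finset.card {w : Fin (p + 1) → Fin (Module.finrank ℂ H) | w 0 = w (Fin.last p)} *
        (‖h‖ ^ p * B) := by
  obtain ⟨b, d, hxb, hd⟩ := exists_orthonormalBasis_apply_eq_smul hx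
  have hwalk := norm_walkProd_le (p := p) (norm_toMatrix_apply_le b h)
  have hhasse : ∀ z ∈ s, |(hasseDeriv p q).eval z| ≤ B / p.factorial := fun z hz => by
    have hz := hB z hz
    rw [iteratedDeriv_eval, abs_mul, Nat.abs_cast] at hz
    exact (le_div_iff₀' (by positivity)).2 hz
  have hterm : ∀ w : Fin (p + 1) → Fin (Module.finrank ℂ H),
      ‖walkProd (LinearMap.toMatrix b.toBasis b.toBasis (h : H →ₗ[ℂ] H)) w *
        (polyDividedDiff (d ∘ w) q : ℝ)‖ ≤ ‖h‖ ^ p * (B / p.factorial) := fun w => by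
    rw [norm_mul, Complex.norm_real]
    gcongr
    · exact hwalk w
    · exact abs_polyDividedDiff_le hs _ (fun k => hspec (hd (w k))) q hhasse
  rw [← b.coe_toBasis] at hxb
  rw [iteratedDeriv_traceFun_eval_zero b.toBasis hx hh hxb, norm_mul, Complex.norm_natCast]
  calc (p.factorial : ℝ) * ‖_‖
      ≤ p.factorial * (Finset.card _ • (‖h‖ ^ p * (B / p.factorial))) := by
        gcongr
        exact (norm_sum_le _ _).trans (Finset.sum_le_card_nsmul _ _ _ fun w _ => hterm w)
    _ = _ := by
        rw [nsmul_eq_mul]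
        field_simp

theorem uniformCauchySeqOn_iteratedDeriv_traceFun_eval {κ : Type*} {l : Filter κ} {q : κ → ℝ[X]}
    {s U : Set ℝ} (hx : IsSelfAdjoint x) (hh : IsSelfAdjoint h) (hs : Convex ℝ s)
    (hspec : ∀ t ∈ U, spectrum ℝ (x + (t : ℂ) • h) ⊆ s) (p : ℕ)
    (hq : UniformCauchySeqOn (fun m => iteratedDeriv p fun z => (q m).eval z) l s) :
    UniformCauchySeqOn (fun m => iteratedDeriv p (traceFun (fun z => (q m).eval z) x h)) l U := by
  set K : ℝ := Finset.card {w : Fin (p + 1) → Fin (Module.finrank ℂ H) | w 0 = w (Fin.last p)} *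
    ‖h‖ ^ p
  have hK : 0 ≤ K := by positivity
  intro u hu
  obtain ⟨ε, hε, hεu⟩ := Metric.mem_uniformity_dist.1 hu
  filter_upwards [hq _ (Metric.dist_mem_uniformity (show 0 < ε / (K + 1) by positivity))]
    with m hm t ht
  apply hεu
  have hy := isSelfAdjoint_add_ofReal_smul hx hh t
  have hB : ∀ z ∈ s, |iteratedDeriv p (fun z => (q m.1 - q m.2).eval z) z| ≤ ε / (K + 1) :=
    fun z hz => by
      rw [iteratedDeriv_eval, map_sub, eval_sub, mul_sub, ← iteratedDeriv_eval,
        ← iteratedDeriv_eval, ← Real.dist_eq]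
      exact (hm z hz).le
  calc dist (iteratedDeriv p (traceFun (fun z => (q m.1).eval z) x h) t)
        (iteratedDeriv p (traceFun (fun z => (q m.2).eval z) x h) t)
      = ‖iteratedDeriv p (traceFun (fun z => (q m.1 - q m.2).eval z) x h) t‖ := by
        rw [dist_eq_norm, traceFun_eval_sub hx hh, iteratedDeriv_sub
          (contDiff_traceFun_eval hx hh _).contDiffAt (contDiff_traceFun_eval hx hh _).contDiffAt]
    _ ≤ K * (ε / (K + 1)) := by
        rw [iteratedDeriv_traceFun, mul_assoc]
        exact norm_iteratedDeriv_traceFun_eval_zero_le hy hh hs (hspec t ht) _ hB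
    _ < ε := by
        rw [← mul_div_assoc, div_lt_iff₀ (by positivity)]
        linarith

theorem tendsto_traceFun {κ : Type*} {l : Filter κ} {F : κ → ℝ → ℝ} {f : ℝ → ℝ} {s : Set ℝ} {t : ℝ}
    (hspec : spectrum ℝ (x + (t : ℂ) • h) ⊆ s) (hF : ∀ m, ContinuousOn (F m) s)
    (hlim : TendstoUniformlyOn F f l s) :
    Tendsto (fun m => traceFun (F m) x h t) l (𝓝 (traceFun f x h t)) := by
  let tr : (H →L[ℂ] H) →ₗ[ℂ] ℂ := LinearMap.trace ℂ H ∘ₗ ContinuousLinearMap.coeLM ℂ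
  have htr : Continuous tr := tr.continuous_of_finiteDimensional
  exact (htr.tendsto _).comp
    (tendsto_cfc_fun (hlim.mono hspec) (Eventually.of_forall fun m => (hF m).mono hspec))

theorem tendstoUniformlyOn_iteratedDeriv_traceFun_eval {κ : Type*} {l : Filter κ} [l.NeBot]
    {q : κ → ℝ[X]} {f : ℝ → ℝ} {s U : Set ℝ} {N : ℕ∞} (hx : IsSelfAdjoint x)
    (hh : IsSelfAdjoint h) (hs : Convex ℝ s) (hU : IsOpen U)
    (hspec : ∀ t ∈ U, spectrum ℝ (x + (t : ℂ) • h) ⊆ s)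
    (hq : ∀ k : ℕ, (k : ℕ∞) ≤ N →
      TendstoUniformlyOn (fun m => iteratedDeriv k fun z => (q m).eval z) (iteratedDeriv k f) l s)
    (k : ℕ) (hk : (k : ℕ∞) ≤ N) :
    TendstoUniformlyOn (fun m => iteratedDeriv k (traceFun (fun z => (q m).eval z) x h))
      (iteratedDeriv k (traceFun f x h)) l U := by
  refine tendstoUniformlyOn_iteratedDeriv hU (fun m => contDiff_traceFun_eval hx hh (q m))
    (fun k hk => uniformCauchySeqOn_iteratedDeriv_traceFun_eval hx hh hs hspec k
      (hq k hk).uniformCauchySeqOn) (fun t ht => ?_) k hk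
  refine tendsto_traceFun (hspec t ht) (fun m => (q m).continuous.continuousOn) ?_
  simpa only [Nat.cast_zero, iteratedDeriv_zero] using hq 0 (mod_cast zero_le)

theorem contDiffOn_traceFun {J U : Set ℝ} (hJ : IsOpen J) {c d : ℝ} (hcd : Set.Icc c d ⊆ J)
    {N : ℕ∞} {f : ℝ → ℝ} (hf : ContDiffOn ℝ N f J) (hx : IsSelfAdjoint x) (hh : IsSelfAdjoint h)
    (hU : IsOpen U) (hspec : ∀ t ∈ U, spectrum ℝ (x + (t : ℂ) • h) ⊆ Set.Icc c d) :
    ContDiffOn ℝ N (traceFun f x h) U := by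
  obtain ⟨q, hq⟩ := exists_polynomial_seq_tendstoUniformlyOn hJ hcd hf
  exact contDiffOn_of_tendstoUniformlyOn_iteratedDeriv hU
    (fun m => contDiff_traceFun_eval hx hh (q m))
    (tendstoUniformlyOn_iteratedDeriv_traceFun_eval hx hh (convex_Icc c d) hU hspec hq)

theorem iteratedDeriv_traceFun_zero {ι : Type*} [Fintype ι] [DecidableEq ι]
    (b : Module.Basis ι ℂ H) {d : ι → ℝ} (hd : ∀ i, x (b i) = (d i : ℂ) • b i) {J : Set ℝ}
    (hJ : IsOpen J) (hJc : J.OrdConnected) {N : ℕ∞} {f : ℝ → ℝ} (hf : ContDiffOn ℝ N f J)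
    (hx : IsSelfAdjoint x) (hh : IsSelfAdjoint h) (hspec : spectrum ℝ x ⊆ J) (p : ℕ)
    (hp : (p : ℕ∞) ≤ N) :
    iteratedDeriv p (traceFun f x h) 0 =
      p.factorial * ∑ w : Fin (p + 1) → ι with w 0 = w (Fin.last p),
        walkProd (LinearMap.toMatrix b b (h : H →ₗ[ℂ] H)) w * (dividedDiff f (d ∘ w) : ℝ) := by
  obtain ⟨c, e, hce, ε, hε, hnear⟩ := exists_spectrum_add_smul_subset_Icc hJ hJc x h hspec
  simp only [← Complex.coe_smul] at hnear
  obtain ⟨q, hq⟩ := exists_polynomial_seq_tendstoUniformlyOn hJ hce hf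
  have h0 : (0 : ℝ) ∈ Set.Ioo (-ε) ε := ⟨neg_lt_zero.2 hε, hε⟩
  have hmem : ∀ i, d i ∈ Set.Icc c e := fun i =>
    hnear 0 h0 (mem_spectrum_of_apply_eq_smul (b.ne_zero i) (by simp [hd]))
  have hdd : ∀ w : Fin (p + 1) → ι, Tendsto (fun m => polyDividedDiff (d ∘ w) (q m)) atTop
      (𝓝 (dividedDiff f (d ∘ w))) := fun w => by
    simpa only [dividedDiff_eval] using tendsto_dividedDiff (d ∘ w) fun k hk i =>
      (hq k ((Nat.cast_le.2 hk).trans hp)).tendsto_at (hmem (w i))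
  refine tendsto_nhds_unique ((tendstoUniformlyOn_iteratedDeriv_traceFun_eval hx hh
    (convex_Icc c e) isOpen_Ioo hnear hq p hp).tendsto_at h0) ?_
  simp only [iteratedDeriv_traceFun_eval_zero b hx hh hd]
  exact Tendsto.const_mul _ (tendsto_finsetSum _ fun w _ =>
    Tendsto.const_mul _ ((Complex.continuous_ofReal.tendsto _).comp (hdd w)))

end TraceFun

theorem mainTheorem4_general {H : Type*} [NormedAddCommGroup H] [InnerProductSpace ℂ H]
    [CompleteSpace H] [FiniteDimensional ℂ H] (n : ℕ) (hn : Module.finrank ℂ H = n)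
    (J : Set ℝ) (hJ : IsOpen J) (hJc : J.OrdConnected) (N : ℕ∞) (f : ℝ → ℝ)
    (hf : ContDiffOn ℝ N f J)
    (x h : H →L[ℂ] H) (hx : IsSelfAdjoint x) (hh : IsSelfAdjoint h)
    (e : Fin n → Fin n → (H →L[ℂ] H)) (he : IsMatrixUnits e)
    (lam : Fin n → ℝ) (hc : Fin n → Fin n → ℂ)
    (hxe : x = ∑ i, (lam i : ℂ) • e i i) (hhe : h = ∑ i, ∑ j, hc i j • e i j)
    (hspec : spectrum ℝ x ⊆ J) :
    (∃ ε : ℝ, 0 < ε ∧ (∀ t ∈ Set.Ioo (-ε) ε, spectrum ℝ (x + (t : ℂ) • h) ⊆ J) ∧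
      ContDiffOn ℝ N (traceFun f x h) (Set.Ioo (-ε) ε)) ∧
    ∀ (p : ℕ) (hp : 0 < p), (p : ℕ∞) ≤ N →
      iteratedDeriv p (traceFun f x h) 0 =
        (p.factorial : ℂ) * ∑ i : Fin p → Fin n,
          (∏ k : Fin p, hc (i k) (i (finRotate p k))) *
            (dividedDiff f
              (Fin.snoc (α := fun _ => ℝ) (fun k : Fin p => lam (i k)) (lam (i ⟨0, hp⟩))) : ℂ) := by
  obtain ⟨b, hb⟩ := he.exists_orthonormalBasis hn
  have hxb : ∀ k, x (b.toBasis k) = (lam k : ℂ) • b.toBasis k := fun k => by simp [hxe, hb]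
  have hmat : LinearMap.toMatrix b.toBasis b.toBasis (h : H →ₗ[ℂ] H) = Matrix.of hc := by
    ext i j
    simp [LinearMap.toMatrix_apply, hhe, hb, Finset.sum_apply]
  constructor
  · obtain ⟨c, d, hcd, ε, hε, hnear⟩ := exists_spectrum_add_smul_subset_Icc hJ hJc x h hspec
    simp only [← Complex.coe_smul] at hnear
    exact ⟨ε, hε, fun t ht => (hnear t ht).trans hcd,
      contDiffOn_traceFun hJ hcd hf hx hh isOpen_Ioo hnear⟩
  · rintro (_ | p) hp hpN
    · exact absurd hp (lt_irrefl 0)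
    rw [iteratedDeriv_traceFun_zero b.toBasis hxb hJ hJc hf hx hh hspec _ hpN,
      sum_closed_eq_sum_snoc]
    simp only [walkProd_snoc, hmat, Fin.comp_snoc]
    rfl

theorem mainTheorem4 {H : Type*} [NormedAddCommGroup H] [InnerProductSpace ℂ H]
    [CompleteSpace H] [FiniteDimensional ℂ H] (n : ℕ) (hn : Module.finrank ℂ H = n)
    (a b : ℝ) (f : ℝ → ℝ) (hf : ContDiffOn ℝ ∞ f (Set.Ioo a b))
    (x h : H →L[ℂ] H) (hx : IsSelfAdjoint x) (hh : IsSelfAdjoint h)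
    (e : Fin n → Fin n → (H →L[ℂ] H)) (he : IsMatrixUnits e)
    (lam : Fin n → ℝ) (hc : Fin n → Fin n → ℂ)
    (hxe : x = ∑ i, (lam i : ℂ) • e i i) (hhe : h = ∑ i, ∑ j, hc i j • e i j)
    (hspec : spectrum ℝ x ⊆ Set.Ioo a b) :
    (∃ ε : ℝ, 0 < ε ∧ (∀ t ∈ Set.Ioo (-ε) ε, spectrum ℝ (x + (t : ℂ) • h) ⊆ Set.Ioo a b) ∧
      ContDiffOn ℝ ∞ (traceFun f x h) (Set.Ioo (-ε) ε)) ∧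
    ∀ (p : ℕ) (hp : 0 < p),
      iteratedDeriv p (traceFun f x h) 0 =
        (p.factorial : ℂ) * ∑ i : Fin p → Fin n,
          (∏ k : Fin p, hc (i k) (i (finRotate p k))) *
            (dividedDiff f
              (Fin.snoc (α := fun _ => ℝ) (fun k : Fin p => lam (i k)) (lam (i ⟨0, hp⟩))) : ℂ) := by
  exact (mainTheorem4_general n hn (Set.Ioo a b) isOpen_Ioo Set.ordConnected_Ioo ⊤ f hf x h hx hh
    e he lam hc hxe hhe hspec).imp_right fun hformula p hp => hformula p hp le_top
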